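/- For a poset $P$ and $k\in\mathbb N$ (with $0\in\mathbb N$), let $P[k]$ be the poset of $k$-chains $x_1\le x_2\le\dots\le x_k$ of elements of $P$ (repetitions allowed), ordered componentwise: $(x_i)\le(y_i)$ if and only if $x_i\le y_i$ for all $i$. For $n\in\mathbb N$, let $I_n$ (the poset of isotropic flags) be the set of all subsets of $\{1,\dots,n\}\sqcup\{1',\dots,n'\}$ that contain no pair $\{i,i'\}$, $1\le i\le n$, ordered by inclusion. A finite poset $P$ is graded of rank $N$ if every maximal chain of $P$ has $N+1$ elements; its rank function $\rho$ is then determined by $\rho(x)=0$ for $x$ minimal and $\rho(x)=\rho(y)+1$ whenever $x$ covers $y$, and $P_i=\{x\in P:\rho(x)=i\}$, $0\le i\le N$, are its levels. A finite graded poset $P$ is strongly Sperner if for every $m\in\mathbb N$ no union of $m$ antichains of $P$ has more elements than the union of the $m$ largest levels of $P$ (of all levels, if $m>N+1$). It is rank-log concave if $|P_i|^2\ge|P_{i-1}|\,|P_{i+1}|$ for all $1\le i\le N-1$. **Theorem.** For all $n,k\in\mathbb N$, the poset $I_n[k]$ is graded, strongly Sperner and rank-log concave. -/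

import Mathlib

/-- The poset `P[k]` of `k`-chains `x₁ ≤ x₂ ≤ ⋯ ≤ x_k` of `P` (repetitions allowed), that is,
monotone maps `Fin k → P`; the order is componentwise. -/
abbrev ChainPoset (P : Type*) [PartialOrder P] (k : ℕ) : Type _ := Fin k →o P

instance ChainPoset.instFinite (P : Type*) [PartialOrder P] [Finite P] (k : ℕ) :
    Finite (ChainPoset P k) :=
  Finite.of_injective (fun f : ChainPoset P k => (f : Fin k → P)) DFunLike.coe_injective

/-- The poset `I_n` of isotropic flags: the subsets of `{1, …, n} ⊔ {1', …, n'}` which contain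
no pair `{i, i'}`, ordered by inclusion. Here `Sum.inl i` stands for `i`, `Sum.inr i` for `i'`. -/
abbrev IsotropicFlags (n : ℕ) : Type :=
  {s : Finset (Fin n ⊕ Fin n) // ∀ i : Fin n, ¬ (Sum.inl i ∈ s ∧ Sum.inr i ∈ s)}

/-- `P` is graded of rank `N` with rank function `ρ`: every maximal chain runs through
`N + 1` elements, `ρ` vanishes at the minimal elements and goes up by one along covers. -/
structure IsGradedBy (P : Type*) [PartialOrder P] (N : ℕ) (ρ : P → ℕ) : Prop where
  encard_maxChain : ∀ C : Set P, IsMaxChain (· ≤ ·) C → C.encard = (N : ℕ∞) + 1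
  rank_of_isMin : ∀ x : P, IsMin x → ρ x = 0
  rank_of_covBy : ∀ x y : P, y ⋖ x → ρ x = ρ y + 1

/-- The level `P_i` of the elements of rank `i`. -/
def rankLevel {P : Type*} (ρ : P → ℕ) (i : ℕ) : Set P := {x | ρ x = i}

/-- `S` is the index set of `m` largest levels among `P_0, …, P_N` (of all the levels,
if there are fewer than `m`). -/
def IsLargestLevels {P : Type*} (N : ℕ) (ρ : P → ℕ) (m : ℕ) (S : Finset ℕ) : Prop :=
  S ⊆ Finset.range (N + 1) ∧ S.card = min m (N + 1) ∧
    ∀ i ∈ S, ∀ j ∈ Finset.range (N + 1), j ∉ S → (rankLevel ρ j).ncard ≤ (rankLevel ρ i).ncard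

/-- The `m`-Sperner property: no union of `m` antichains has more elements than
the union of the `m` largest levels. -/
def HasSpernerProperty {P : Type*} [PartialOrder P] [Finite P] (N : ℕ) (ρ : P → ℕ) (m : ℕ) :
    Prop :=
  ∀ A : Fin m → Set P, (∀ j, IsAntichain (· ≤ ·) (A j)) →
    ∀ S : Finset ℕ, IsLargestLevels N ρ m S →
      (⋃ j, A j).ncard ≤ (⋃ i ∈ S, rankLevel ρ i).ncard

/-- The finite poset `P` is graded and has the `m`-Sperner property for all `m`. (The rank and
the rank function of a finite graded poset are unique.) -/
def StronglySperner (P : Type*) [PartialOrder P] [Finite P] : Prop :=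
  ∃ (N : ℕ) (ρ : P → ℕ), IsGradedBy P N ρ ∧ ∀ m : ℕ, HasSpernerProperty N ρ m

/-- The finite poset `P` is graded, of rank `N` say, and `|P_i|² ≥ |P_{i-1}| |P_{i+1}|`
for `1 ≤ i ≤ N - 1` (written with `i + 1` in place of `i`). -/
def RankLogConcave (P : Type*) [PartialOrder P] [Finite P] : Prop :=
  ∃ (N : ℕ) (ρ : P → ℕ), IsGradedBy P N ρ ∧ ∀ i : ℕ, i + 2 ≤ N →
    (rankLevel ρ i).ncard * (rankLevel ρ (i + 2)).ncard ≤ (rankLevel ρ (i + 1)).ncard ^ 2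

/-! A `k`-chain of isotropic flags is determined by how many of its flags contain `i` and how many
contain `i'`, for each `i`. At most one of these two numbers is nonzero, so they form a point of a
spider with two legs of length `k`. Hence `I_n[k]` is the `n`-th power of this spider
(`flagChainOrderIso`).

The spider has level sizes 1, 2, …, 2, which are log-concave, and putting weight 1/2 on each cover
is a normalized flow. Harper's theorem (`IsLogConcaveFlowPoset.prod`) says that log-concave level
sizes together with a normalized flow survive products. Level sizes convolve, and Cauchy–Binet keeps
them log-concave. The flow on a product moves the rank distribution of the first coordinate from one
level to the next by steps of 0 or 1; log-concavity of the factors is what makes the required masses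
nonnegative.

Pushing an antichain down along the flow gives the LYM inequality
(`IsLogConcaveFlowPoset.sum_inv_levelCard_le_one`). Summed over `m` antichains, it bounds the total
fraction of levels covered by `m`, which yields the strong Sperner property. -/

/-! ### Log-concave sequences and their convolutions -/

/-- Log-concavity of a two-sided sequence, in the form which also excludes internal zeros. -/
def IsLogConcaveSeq (p : ℤ → ℚ) : Prop :=
  ∀ i j m : ℤ, i ≤ j → 0 ≤ m → p i * p (j + m) ≤ p (i + m) * p j

/-- The partial sum `∑_{0 ≤ t ≤ i} p_t q_{l - t}` of the convolution of `p` and `q`. -/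
noncomputable def partialConv (p q : ℤ → ℚ) (l i : ℤ) : ℚ := ∑ t ∈ Finset.Icc 0 i, p t * q (l - t)

theorem sum_shift_eq_partialConv {p : ℤ → ℚ} (q : ℤ → ℚ) (hp : ∀ i < 0, p i = 0) (l i : ℤ)
    {m : ℤ} (hm : 0 ≤ m) :
    ∑ t ∈ Finset.Icc 0 i, p (t - m) * q (l - t) = partialConv p q (l - m) (i - m) := by
  unfold partialConv
  have h : Finset.Icc m i = (Finset.Icc 0 (i - m)).map (addRightEmbedding m) := by
    rw [Finset.map_add_right_Icc]; simp
  have hs : Finset.Icc m i ⊆ Finset.Icc 0 i := Finset.Icc_subset_Icc_left hm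
  rw [← Finset.sum_subset hs, h, Finset.sum_map]
  · refine Finset.sum_congr rfl fun t _ => ?_
    simp only [addRightEmbedding_apply, add_sub_cancel_right]
    congr 2; ring
  · intro t ht ht'
    rw [hp (t - m) (by simp only [Finset.mem_Icc] at ht ht'; omega), zero_mul]

theorem partialConv_eq_of_le {p q : ℤ → ℚ} {l i j : ℤ} (hij : i ≤ j)
    (h : ∀ t, i < t → p t * q (l - t) = 0) : partialConv p q l i = partialConv p q l j := by
  refine Finset.sum_subset (Finset.Icc_subset_Icc_right hij) fun t ht ht' => h t ?_
  simp only [Finset.mem_Icc] at ht ht'; omega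

theorem partialConv_sub {p q : ℤ → ℚ} {l i : ℤ} (hi : 0 ≤ i) :
    partialConv p q l i - partialConv p q l (i - 1) = p i * q (l - i) := by
  unfold partialConv
  have h : Finset.Icc 0 i = insert i (Finset.Icc 0 (i - 1)) := by
    ext t; simp only [Finset.mem_Icc, Finset.mem_insert]; omega
  rw [h, Finset.sum_insert (by simp)]; ring

/-- Twice the difference of the two sides is a double sum of products of 2×2 minors. Exchanging `i`
and `j` flips both signs, so each product is nonnegative. -/
theorem cauchyBinet_nonneg (s : Finset ℤ) (a b x y : ℤ → ℚ)
    (hab : ∀ i j, i < j → a j * b i ≤ a i * b j) (hxy : ∀ i j, i < j → x j * y i ≤ x i * y j) :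
    (∑ i ∈ s, a i * y i) * (∑ i ∈ s, b i * x i) ≤
      (∑ i ∈ s, a i * x i) * (∑ i ∈ s, b i * y i) := by
  have key : 0 ≤ ∑ i ∈ s, ∑ j ∈ s, (a i * b j - a j * b i) * (x i * y j - x j * y i) := by
    refine Finset.sum_nonneg fun i _ => Finset.sum_nonneg fun j _ => ?_
    rcases lt_trichotomy i j with h | rfl | h
    · exact mul_nonneg (sub_nonneg.2 (hab i j h)) (sub_nonneg.2 (hxy i j h))
    · simp
    · exact mul_nonneg_of_nonpos_of_nonpos (sub_nonpos.2 (hab j i h)) (sub_nonpos.2 (hxy j i h))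
  have e : ∑ i ∈ s, ∑ j ∈ s, (a i * b j - a j * b i) * (x i * y j - x j * y i) =
      2 * ((∑ i ∈ s, a i * x i) * (∑ i ∈ s, b i * y i) -
        (∑ i ∈ s, a i * y i) * (∑ i ∈ s, b i * x i)) := by
    have h1 : ∑ i ∈ s, ∑ j ∈ s, (a i * b j - a j * b i) * (x i * y j - x j * y i) =
        ∑ i ∈ s, ∑ j ∈ s, ((a i * x i) * (b j * y j) + (b i * y i) * (a j * x j)
          - (a i * y i) * (b j * x j) - (b i * x i) * (a j * y j)) :=
      Finset.sum_congr rfl fun i _ => Finset.sum_congr rfl fun j _ => by ring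
    rw [h1]
    simp only [Finset.sum_sub_distrib, Finset.sum_add_distrib, ← Finset.sum_mul_sum]
    ring
  linarith

/-- This is Cauchy–Binet for the rows `p` and `p` shifted by `m`, against the columns of `q`
reflected at `i + m` and `j + m`. -/
theorem IsLogConcaveSeq.conv {p q : ℤ → ℚ} (hp : IsLogConcaveSeq p) (hq : IsLogConcaveSeq q)
    {N : ℤ} (hp0 : ∀ i < 0, p i = 0) (hpN : ∀ i, N < i → p i = 0) :
    IsLogConcaveSeq fun l => partialConv p q l N := by
  intro i j m hij hm
  -- The range is lengthened to `N + m` so that it also holds the support of the shifted `p`.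
  have hN : ∀ l, partialConv p q l N = ∑ t ∈ Finset.Icc 0 (N + m), p t * q (l - t) := fun l =>
    partialConv_eq_of_le (by omega) fun t ht => by rw [hpN t ht, zero_mul]
  have hS : ∀ l, partialConv p q l N =
      ∑ t ∈ Finset.Icc 0 (N + m), p (t - m) * q (l + m - t) := fun l => by
    rw [sum_shift_eq_partialConv q hp0 _ _ hm]; simp
  have := cauchyBinet_nonneg (Finset.Icc 0 (N + m)) p (fun t => p (t - m))
    (fun t => q (i + m - t)) (fun t => q (j + m - t)) ?_ ?_
  · simp only [← hN, ← hS] at this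
    linarith
  · intro s t hst
    have := hp (s - m) (t - m) m (by omega) hm
    simp only [sub_add_cancel] at this
    linarith
  · intro s t hst
    have := hq (i + m - t) (j + m - t) (t - s) (by omega) (by omega)
    rw [show j + m - t + (t - s) = j + m - s by ring,
      show i + m - t + (t - s) = i + m - s by ring] at this
    exact this

/-- The contributions of `D × D` to the two sides agree, and `h` compares those of `D × (S \ D)`
term by term. -/
theorem sum_mul_sum_le_of_subset {D S : Finset ℤ} (hDS : D ⊆ S) {f g : ℤ → ℚ}
    (h : ∀ t ∈ D, ∀ s ∈ S \ D, f t * g s ≤ g t * f s) :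
    (∑ t ∈ D, f t) * (∑ s ∈ S, g s) ≤ (∑ t ∈ D, g t) * (∑ s ∈ S, f s) := by
  rw [← Finset.sum_sdiff hDS (f := f), ← Finset.sum_sdiff hDS (f := g)]
  have : (∑ t ∈ D, f t) * (∑ s ∈ S \ D, g s) ≤ (∑ t ∈ D, g t) * (∑ s ∈ S \ D, f s) := by
    rw [Finset.sum_mul_sum, Finset.sum_mul_sum]
    exact Finset.sum_le_sum fun t ht => Finset.sum_le_sum fun s hs => h t ht s hs
  linarith

/-! ### Rank distribution of the first coordinate in a product -/

/-- The distribution function of the first rank on the `l`-th level of a product. -/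
noncomputable def rankCdf (p q : ℤ → ℚ) (N l i : ℤ) : ℚ := partialConv p q l i / partialConv p q l N

section rankCdf

variable {p q : ℤ → ℚ} {N l i : ℤ}

/-- Log-concavity of `q` makes the likelihood ratio `q (l + 1 - t) / q (l - t)` increase with `t`:
one level up, the first rank is stochastically larger. -/
theorem rankCdf_succ_le (hq : IsLogConcaveSeq q) (hp : ∀ i, 0 ≤ p i) (hiN : i ≤ N)
    (hl : 0 < partialConv p q l N) (hl' : 0 < partialConv p q (l + 1) N) :
    rankCdf p q N (l + 1) i ≤ rankCdf p q N l i := by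
  unfold rankCdf
  rw [div_le_div_iff₀ hl' hl]
  refine sum_mul_sum_le_of_subset (Finset.Icc_subset_Icc_right hiN) fun t ht s hs => ?_
  simp only [Finset.mem_sdiff, Finset.mem_Icc] at ht hs
  have := hq (l - s) (l - t) 1 (by omega) zero_le_one
  rw [show l - t + 1 = l + 1 - t by ring, show l - s + 1 = l + 1 - s by ring] at this
  have := mul_le_mul_of_nonneg_left this (mul_nonneg (hp t) (hp s))
  linarith

/-- The counterpart with the factors exchanged: one level up, the first rank grows stochastically by
at most 1, by the likelihood ratio `p t / p (t - 1)`. -/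
theorem rankCdf_pred_le (hp : IsLogConcaveSeq p) (hq0 : ∀ i, 0 ≤ q i) (hp0 : ∀ i < 0, p i = 0)
    (hpN : ∀ i, N < i → p i = 0) (hiN : i ≤ N)
    (hl : 0 < partialConv p q l N) (hl' : 0 < partialConv p q (l + 1) N) :
    rankCdf p q N l (i - 1) ≤ rankCdf p q N (l + 1) i := by
  unfold rankCdf
  rw [div_le_div_iff₀ hl hl']
  have h1 := sum_shift_eq_partialConv q hp0 (l + 1) i zero_le_one
  have h2 := sum_shift_eq_partialConv q hp0 (l + 1) (N + 1) zero_le_one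
  have h3 : partialConv p q (l + 1) N = partialConv p q (l + 1) (N + 1) :=
    partialConv_eq_of_le (by omega) fun t ht => by rw [hpN t ht, zero_mul]
  simp only [add_sub_cancel_right] at h1 h2
  rw [← h1, ← h2, h3]
  refine sum_mul_sum_le_of_subset (Finset.Icc_subset_Icc_right (by omega)) fun t ht s hs => ?_
  simp only [Finset.mem_sdiff, Finset.mem_Icc] at ht hs
  have := hp (t - 1) (s - 1) 1 (by omega) zero_le_one
  simp only [sub_add_cancel] at this
  have := mul_le_mul_of_nonneg_left this (mul_nonneg (hq0 (l + 1 - t)) (hq0 (l + 1 - s)))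
  linarith

theorem rankCdf_self (hl : 0 < partialConv p q l N) : rankCdf p q N l N = 1 := div_self hl.ne'

theorem rankCdf_eq_one (hl : 0 < partialConv p q l N) (hiN : i ≤ N)
    (h : ∀ t, i < t → q (l - t) = 0) : rankCdf p q N l i = 1 := by
  unfold rankCdf
  rw [partialConv_eq_of_le hiN fun t ht => by rw [h t ht, mul_zero], div_self hl.ne']

theorem rankCdf_eq_zero (h : ∀ t, 0 ≤ t → t ≤ i → q (l - t) = 0) : rankCdf p q N l i = 0 := by
  unfold rankCdf partialConv
  rw [Finset.sum_eq_zero fun t ht => ?_, zero_div]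
  rw [h t (Finset.mem_Icc.1 ht).1 (Finset.mem_Icc.1 ht).2, mul_zero]

theorem rankCdf_sub (hi : 0 ≤ i) :
    rankCdf p q N l i - rankCdf p q N l (i - 1) = p i * q (l - i) / partialConv p q l N := by
  rw [rankCdf, rankCdf, ← sub_div, partialConv_sub hi]

end rankCdf

/-! ### Level sizes and normalized flows -/

/-- The number of elements of rank `i`, as a two-sided sequence. -/
def levelCard {P : Type*} [Fintype P] (ρ : P → ℕ) (i : ℤ) : ℚ :=
  ((Finset.univ.filter fun x => (ρ x : ℤ) = i).card : ℚ)

theorem levelCard_nonneg {P : Type*} [Fintype P] (ρ : P → ℕ) (i : ℤ) : 0 ≤ levelCard ρ i :=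
  Nat.cast_nonneg _

theorem levelCard_eq_zero {P : Type*} [Fintype P] {ρ : P → ℕ} {i : ℤ} (h : ∀ x, (ρ x : ℤ) ≠ i) :
    levelCard ρ i = 0 := by
  simp [levelCard, h]

theorem levelCard_of_neg {P : Type*} [Fintype P] (ρ : P → ℕ) : ∀ i < 0, levelCard ρ i = 0 :=
  fun i hi => levelCard_eq_zero fun x => by omega

theorem levelCard_of_gt {P : Type*} [Fintype P] {ρ : P → ℕ} {N : ℕ} (hρ : ∀ x, ρ x ≤ N) :
    ∀ i : ℤ, N < i → levelCard ρ i = 0 :=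
  fun i hi => levelCard_eq_zero fun x => by have := hρ x; omega

theorem levelCard_eq_sum {P : Type*} [Fintype P] (ρ : P → ℕ) (i : ℤ) :
    levelCard ρ i = ∑ x : P, if (ρ x : ℤ) = i then 1 else 0 := by
  simp [levelCard]

/-- A normalized flow: nonnegative weights on the pairs of comparable elements of consecutive
ranks whose marginals are the uniform distributions on the levels. -/
structure IsNormalizedFlow {P : Type*} [PartialOrder P] [Fintype P] (N : ℕ) (ρ : P → ℕ)
    (w : P → P → ℚ) : Prop where
  nonneg : ∀ x y, 0 ≤ w x y
  lt : ∀ x y, w x y ≠ 0 → x < y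
  rank : ∀ x y, w x y ≠ 0 → ρ y = ρ x + 1
  sum_out : ∀ x, ρ x < N → ∑ y, w x y = (levelCard ρ (ρ x))⁻¹
  sum_in : ∀ y, 0 < ρ y → ∑ x, w x y = (levelCard ρ (ρ y))⁻¹

/-- A graded poset with log-concave level sizes which has a normalized flow. -/
structure IsLogConcaveFlowPoset (P : Type*) [PartialOrder P] [Fintype P] (N : ℕ) (ρ : P → ℕ) :
    Prop where
  rank_of_isMin : ∀ x, IsMin x → ρ x = 0
  rank_of_isMax : ∀ x, IsMax x → ρ x = N
  rank_of_covBy : ∀ x y, y ⋖ x → ρ x = ρ y + 1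
  rank_le : ∀ x, ρ x ≤ N
  levelCard_pos : ∀ i : ℤ, 0 ≤ i → i ≤ N → 0 < levelCard ρ i
  logConcave : IsLogConcaveSeq (levelCard ρ)
  exists_flow : ∃ w, IsNormalizedFlow N ρ w

theorem levelCard_comp_equiv {P Q : Type*} [Fintype P] [Fintype Q] (e : P ≃ Q) (ρ : Q → ℕ) :
    levelCard (ρ ∘ e) = levelCard ρ := by
  funext i
  rw [levelCard_eq_sum, levelCard_eq_sum, ← Equiv.sum_comp e]
  rfl

theorem IsLogConcaveFlowPoset.comp_orderIso {P Q : Type*} [PartialOrder P] [Fintype P]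
    [PartialOrder Q] [Fintype Q] {N : ℕ} {ρ : Q → ℕ} (h : IsLogConcaveFlowPoset Q N ρ)
    (e : P ≃o Q) : IsLogConcaveFlowPoset P N (ρ ∘ e) := by
  have hc : levelCard (ρ ∘ e) = levelCard ρ := levelCard_comp_equiv e.toEquiv ρ
  refine ⟨fun x hx => h.rank_of_isMin _ ((e.isMin_apply).2 hx),
    fun x hx => h.rank_of_isMax _ ((e.isMax_apply).2 hx),
    fun x y hxy => h.rank_of_covBy _ _ ((apply_covBy_apply_iff e).2 hxy),
    fun x => h.rank_le _, by rw [hc]; exact h.levelCard_pos, by rw [hc]; exact h.logConcave, ?_⟩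
  obtain ⟨w, hw⟩ := h.exists_flow
  refine ⟨fun x y => w (e x) (e y), fun x y => hw.nonneg _ _,
    fun x y hxy => e.lt_iff_lt.1 (hw.lt _ _ hxy), fun x y hxy => hw.rank _ _ hxy,
    fun x hx => ?_, fun y hy => ?_⟩
  · rw [hc, Function.comp_apply, ← hw.sum_out (e x) hx]
    exact Equiv.sum_comp e.toEquiv fun y => w (e x) y
  · rw [hc, Function.comp_apply, ← hw.sum_in (e y) hy]
    exact Equiv.sum_comp e.toEquiv fun x => w x (e y)

theorem levelCard_prod {P Q : Type*} [Fintype P] [Fintype Q] {N : ℕ} {ρ : P → ℕ} {σ : Q → ℕ}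
    (hρ : ∀ x, ρ x ≤ N) (l : ℤ) :
    levelCard (fun z : P × Q => ρ z.1 + σ z.2) l =
      partialConv (levelCard ρ) (levelCard σ) l N := by
  unfold partialConv
  simp only [levelCard_eq_sum, Finset.sum_mul_sum, Fintype.sum_prod_type]
  symm
  rw [Finset.sum_comm]
  refine Finset.sum_congr rfl fun x _ => ?_
  rw [Finset.sum_comm]
  refine Finset.sum_congr rfl fun y _ => ?_
  rw [Finset.sum_eq_single (ρ x : ℤ)]
  · simp only [if_true, one_mul]
    refine if_congr ?_ rfl rfl
    push_cast; omega
  · intro t _ ht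
    rw [if_neg (Ne.symm ht), zero_mul]
  · intro h
    have := hρ x
    simp only [Finset.mem_Icc] at h
    omega

/-! ### Harper's product theorem -/

section prod

variable {P Q : Type*} [PartialOrder P] [Fintype P] [PartialOrder Q] [Fintype Q] {N M : ℕ}
  {ρ : P → ℕ} {σ : Q → ℕ}

theorem levelCard_prod_pos (hP : IsLogConcaveFlowPoset P N ρ) (hQ : IsLogConcaveFlowPoset Q M σ)
    (l : ℤ) (h0 : 0 ≤ l) (hl : l ≤ N + M) :
    0 < partialConv (levelCard ρ) (levelCard σ) l N := by
  refine Finset.sum_pos' (fun t _ => mul_nonneg (levelCard_nonneg _ _) (levelCard_nonneg _ _))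
    -- Take the first rank as large as possible; the second is then at most `M`.
    ⟨min l N, by simp [h0], mul_pos (hP.levelCard_pos _ ?_ ?_) (hQ.levelCard_pos _ ?_ ?_)⟩ <;> omega

/-- Let `F_l` be the distribution function of the first rank on level `l`. From first rank `i`, the
mass `F_l(i) - F_{l+1}(i)` moves to `i + 1` along `v`, and the mass `F_{l+1}(i) - F_l(i - 1)` keeps
`i` and moves along `w`; the idle coordinate stays uniform on its level. Both masses are nonnegative
by `rankCdf_succ_le` and `rankCdf_pred_le`, and the sums telescope to the mass of a pair of ranks.
-/
theorem IsNormalizedFlow.prod [DecidableEq P] [DecidableEq Q] (hP : IsLogConcaveFlowPoset P N ρ)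
    (hQ : IsLogConcaveFlowPoset Q M σ) {v : P → P → ℚ} {w : Q → Q → ℚ} (hv : IsNormalizedFlow N ρ v)
    (hw : IsNormalizedFlow M σ w) :
    IsNormalizedFlow (N + M) (fun z : P × Q => ρ z.1 + σ z.2) fun a b =>
      (if a.2 = b.2 then v a.1 b.1 *
        ((rankCdf (levelCard ρ) (levelCard σ) N (ρ a.1 + σ a.2) (ρ a.1) -
          rankCdf (levelCard ρ) (levelCard σ) N (ρ a.1 + σ a.2 + 1) (ρ a.1)) /
          levelCard σ (σ a.2)) else 0) +
      (if a.1 = b.1 then w a.2 b.2 *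
        ((rankCdf (levelCard ρ) (levelCard σ) N (ρ a.1 + σ a.2 + 1) (ρ a.1) -
          rankCdf (levelCard ρ) (levelCard σ) N (ρ a.1 + σ a.2) (ρ a.1 - 1)) /
          levelCard ρ (ρ a.1)) else 0) := by
  set p := levelCard ρ with hp
  set q := levelCard σ with hq
  set F := rankCdf p q N with hF
  have hp0 : ∀ x, 0 < p (ρ x) := fun x =>
    hP.levelCard_pos _ (by omega) (by have := hP.rank_le x; omega)
  have hq0 : ∀ y, 0 < q (σ y) := fun y =>
    hQ.levelCard_pos _ (by omega) (by have := hQ.rank_le y; omega)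
  have hpos := levelCard_prod_pos hP hQ
  rw [← hp, ← hq] at hpos
  have hpn := levelCard_of_neg ρ
  have hqn := levelCard_of_neg σ
  have hpN := levelCard_of_gt hP.rank_le
  have hqM := levelCard_of_gt hQ.rank_le
  rw [← hp] at hpn hpN
  rw [← hq] at hqn hqM
  have hvmax : ∀ x x', v x x' ≠ 0 → ρ x < N := fun x x' h => by
    have := hv.rank x x' h; have := hP.rank_le x'; omega
  have hwmax : ∀ x x', w x x' ≠ 0 → σ x < M := fun x x' h => by
    have := hw.rank x x' h; have := hQ.rank_le x'; omega
  constructor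
  · rintro ⟨x, y⟩ ⟨x', y'⟩
    dsimp only
    refine add_nonneg ?_ ?_
    · split_ifs
      · by_cases h : v x x' = 0
        · simp [h]
        have h1 := hvmax _ _ h
        have h2 := hQ.rank_le y
        refine mul_nonneg (hv.nonneg _ _) (div_nonneg (sub_nonneg.2 ?_) (hq0 y).le)
        exact rankCdf_succ_le hQ.logConcave (levelCard_nonneg ρ) (by omega)
          (hpos _ (by omega) (by omega)) (hpos _ (by omega) (by omega))
      · rfl
    · split_ifs
      · by_cases h : w y y' = 0
        · simp [h]
        have h1 := hwmax _ _ h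
        have h2 := hP.rank_le x
        refine mul_nonneg (hw.nonneg _ _) (div_nonneg (sub_nonneg.2 ?_) (hp0 x).le)
        exact rankCdf_pred_le hP.logConcave (levelCard_nonneg σ) hpn hpN (by omega)
          (hpos _ (by omega) (by omega)) (hpos _ (by omega) (by omega))
      · rfl
  · rintro ⟨x, y⟩ ⟨x', y'⟩ h
    dsimp only at h
    by_cases h1 : y = y' ∧ v x x' ≠ 0
    · obtain ⟨rfl, h1⟩ := h1
      exact Prod.mk_lt_mk_iff_left.2 (hv.lt _ _ h1)
    by_cases h2 : x = x' ∧ w y y' ≠ 0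
    · obtain ⟨rfl, h2⟩ := h2
      exact Prod.mk_lt_mk_iff_right.2 (hw.lt _ _ h2)
    refine absurd ?_ h
    push Not at h1 h2
    rw [ite_eq_right_iff.2 fun e => by rw [h1 e, zero_mul],
      ite_eq_right_iff.2 fun e => by rw [h2 e, zero_mul], add_zero]
  · rintro ⟨x, y⟩ ⟨x', y'⟩ h
    dsimp only at h ⊢
    by_cases h1 : y = y' ∧ v x x' ≠ 0
    · obtain ⟨rfl, h1⟩ := h1
      have := hv.rank _ _ h1
      omega
    by_cases h2 : x = x' ∧ w y y' ≠ 0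
    · obtain ⟨rfl, h2⟩ := h2
      have := hw.rank _ _ h2
      omega
    refine absurd ?_ h
    push Not at h1 h2
    rw [ite_eq_right_iff.2 fun e => by rw [h1 e, zero_mul],
      ite_eq_right_iff.2 fun e => by rw [h2 e, zero_mul], add_zero]
  · rintro ⟨x, y⟩ hxy
    dsimp only at hxy ⊢
    rw [levelCard_prod hP.rank_le, ← hp, ← hq]
    simp only [Fintype.sum_prod_type, Finset.sum_add_distrib, Finset.sum_ite_eq, Finset.mem_univ,
      if_true]
    rw [Finset.sum_comm (f := fun x' y' => if x = x' then _ else _)]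
    simp only [Finset.sum_ite_eq, Finset.mem_univ, if_true, ← Finset.sum_mul]
    have hx := hP.rank_le x
    have hy := hQ.rank_le y
    have hl := hpos (ρ x + σ y) (by omega) (by omega)
    have hl' := hpos (ρ x + σ y + 1) (by omega) (by omega)
    -- At the top rank of `P` the value of `∑ x', v x x'` is unknown, but its coefficient is `1 -
    -- 1`. The other boundary cases below are resolved likewise.
    have e1 : (∑ x', v x x') * ((F (ρ x + σ y) (ρ x) - F (ρ x + σ y + 1) (ρ x)) / q (σ y)) =
        (p (ρ x))⁻¹ * ((F (ρ x + σ y) (ρ x) - F (ρ x + σ y + 1) (ρ x)) / q (σ y)) := by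
      rcases hx.lt_or_eq with h | h
      · rw [hv.sum_out x h]
      · rw [h, hF, rankCdf_self, rankCdf_self]
        · simp
        · rwa [h] at hl'
        · rwa [h] at hl
    have e2 : (∑ y', w y y') * ((F (ρ x + σ y + 1) (ρ x) - F (ρ x + σ y) (ρ x - 1)) / p (ρ x)) =
        (q (σ y))⁻¹ * ((F (ρ x + σ y + 1) (ρ x) - F (ρ x + σ y) (ρ x - 1)) / p (ρ x)) := by
      rcases hy.lt_or_eq with h | h
      · rw [hw.sum_out y h]
      · rw [h, hF, rankCdf_eq_zero, rankCdf_eq_zero]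
        · simp
        · intro t _ ht; exact hqM _ (by omega)
        · intro t _ ht; exact hqM _ (by omega)
    have e3 : F (ρ x + σ y) (ρ x) - F (ρ x + σ y) (ρ x - 1) =
        p (ρ x) * q (ρ x + σ y - ρ x) / partialConv p q (ρ x + σ y) N := rankCdf_sub (by omega)
    rw [add_sub_cancel_left] at e3
    have hx0 := (hp0 x).ne'
    have hy0 := (hq0 y).ne'
    rw [e1, e2]
    push_cast
    have : F (ρ x + σ y) (ρ x) = F (ρ x + σ y) (ρ x - 1) +
      p (ρ x) * q (σ y) / partialConv p q (ρ x + σ y) N := by linarith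
    rw [this]
    have := hl.ne'
    field_simp
    ring
  · rintro ⟨x, y⟩ hxy
    dsimp only at hxy ⊢
    rw [levelCard_prod hP.rank_le, ← hp, ← hq]
    simp only [Fintype.sum_prod_type, Finset.sum_add_distrib, Finset.sum_ite_eq', Finset.mem_univ,
      if_true]
    rw [Finset.sum_comm (f := fun x' y' => if x' = x then _ else _)]
    simp only [Finset.sum_ite_eq', Finset.mem_univ, if_true]
    have hx := hP.rank_le x
    have hy := hQ.rank_le y
    obtain ⟨l, hl0⟩ : ∃ l : ℤ, l = ρ x + σ y - 1 := ⟨_, rfl⟩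
    have hl := hpos l (by omega) (by omega)
    have hl' := hpos (l + 1) (by omega) (by omega)
    have e1 : ∑ x', v x' x * ((F (ρ x' + σ y) (ρ x') - F (ρ x' + σ y + 1) (ρ x')) / q (σ y)) =
        (p (ρ x))⁻¹ * ((F l (ρ x - 1) - F (l + 1) (ρ x - 1)) / q (σ y)) := by
      -- Where `v x' x` is nonzero, `ρ x' = ρ x - 1`, so the coefficient does not depend on `x'`.
      have : ∀ x', v x' x * ((F (ρ x' + σ y) (ρ x') - F (ρ x' + σ y + 1) (ρ x')) / q (σ y)) =
          v x' x * ((F l (ρ x - 1) - F (l + 1) (ρ x - 1)) / q (σ y)) := fun x' => by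
        by_cases h : v x' x = 0
        · simp [h]
        have h1 := hv.rank _ _ h
        rw [show (ρ x' : ℤ) + σ y = l by omega, show (ρ x : ℤ) - 1 = ρ x' by omega]
      rw [Finset.sum_congr rfl fun x' _ => this x', ← Finset.sum_mul]
      rcases Nat.eq_zero_or_pos (ρ x) with h | h
      · rw [h, hF, rankCdf_eq_zero, rankCdf_eq_zero]
        · simp
        · intro t _ ht; omega
        · intro t _ ht; omega
      · rw [hv.sum_in x h]
    have e2 : ∑ y', w y' y * ((F (ρ x + σ y' + 1) (ρ x) - F (ρ x + σ y') (ρ x - 1)) / p (ρ x)) =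
        (q (σ y))⁻¹ * ((F (l + 1) (ρ x) - F l (ρ x - 1)) / p (ρ x)) := by
      have : ∀ y', w y' y * ((F (ρ x + σ y' + 1) (ρ x) - F (ρ x + σ y') (ρ x - 1)) / p (ρ x)) =
          w y' y * ((F (l + 1) (ρ x) - F l (ρ x - 1)) / p (ρ x)) := fun y' => by
        by_cases h : w y' y = 0
        · simp [h]
        have h1 := hw.rank _ _ h
        rw [show (ρ x : ℤ) + σ y' = l by omega]
      rw [Finset.sum_congr rfl fun y' _ => this y', ← Finset.sum_mul]
      rcases Nat.eq_zero_or_pos (σ y) with h | h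
      · rw [hF, rankCdf_eq_one hl (by omega), rankCdf_eq_one hl' (by omega)]
        · simp
        · intro t ht; exact hqn _ (by omega)
        · intro t ht; exact hqn _ (by omega)
      · rw [hw.sum_in y h]
    have e3 : F (l + 1) (ρ x) - F (l + 1) (ρ x - 1) =
        p (ρ x) * q (l + 1 - ρ x) / partialConv p q (l + 1) N := rankCdf_sub (by omega)
    rw [show l + 1 - ρ x = (σ y : ℤ) by omega] at e3
    have hx0 := (hp0 x).ne'
    have hy0 := (hq0 y).ne'
    rw [e1, e2]
    push_cast
    rw [show (ρ x : ℤ) + σ y = l + 1 by omega]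
    have : F (l + 1) (ρ x) = F (l + 1) (ρ x - 1) +
      p (ρ x) * q (σ y) / partialConv p q (l + 1) N := by linarith
    rw [this]
    have := hl'.ne'
    field_simp
    ring

/-- Harper's product theorem. -/
theorem IsLogConcaveFlowPoset.prod (hP : IsLogConcaveFlowPoset P N ρ)
    (hQ : IsLogConcaveFlowPoset Q M σ) :
    IsLogConcaveFlowPoset (P × Q) (N + M) fun z => ρ z.1 + σ z.2 := by
  classical
  refine ⟨fun z hz => ?_, fun z hz => ?_, fun z z' hz => ?_, fun z => ?_, fun i h0 hi => ?_, ?_, ?_⟩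
  · rw [hP.rank_of_isMin _ (Prod.isMin_iff.1 hz).1,
      hQ.rank_of_isMin _ (Prod.isMin_iff.1 hz).2]
  · rw [hP.rank_of_isMax _ (Prod.isMax_iff.1 hz).1, hQ.rank_of_isMax _ (Prod.isMax_iff.1 hz).2]
  · rcases Prod.covBy_iff.1 hz with ⟨h, e⟩ | ⟨h, e⟩
    · rw [hP.rank_of_covBy _ _ h, e]; omega
    · rw [hQ.rank_of_covBy _ _ h, e]; omega
  · exact add_le_add (hP.rank_le _) (hQ.rank_le _)
  · rw [levelCard_prod hP.rank_le]
    exact levelCard_prod_pos hP hQ i h0 (by push_cast at hi; exact hi)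
  · have : levelCard (fun z : P × Q => ρ z.1 + σ z.2) =
        fun l => partialConv (levelCard ρ) (levelCard σ) l N :=
      funext fun l => levelCard_prod hP.rank_le l
    rw [this]
    exact hP.logConcave.conv hQ.logConcave (levelCard_of_neg ρ) (levelCard_of_gt hP.rank_le)
  · obtain ⟨v, hv⟩ := hP.exists_flow
    obtain ⟨w, hw⟩ := hQ.exists_flow
    exact ⟨_, IsNormalizedFlow.prod hP hQ hv hw⟩

end prod

/-! ### From flows to LYM, the Sperner property and gradedness -/

theorem ncard_rankLevel {P : Type*} [Fintype P] (ρ : P → ℕ) (i : ℕ) :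
    ((rankLevel ρ i).ncard : ℚ) = levelCard ρ i := by
  classical
  rw [rankLevel, levelCard, Set.ncard_eq_toFinset_card']
  simp

theorem IsMaxChain.mem_of_forall_comparable {P : Type*} [PartialOrder P] {C : Set P}
    (hC : IsMaxChain (· ≤ ·) C) {y : P}
    (hy : ∀ z ∈ C, y ≤ z ∨ z ≤ y) : y ∈ C := by
  have : IsChain (· ≤ ·) (insert y C) := hC.1.insert fun z hz _ => hy z hz
  rw [hC.2 this (Set.subset_insert _ _)]
  exact Set.mem_insert _ _

section sperner

variable {P : Type*} [PartialOrder P] [Fintype P] {N : ℕ} {ρ : P → ℕ}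

theorem IsNormalizedFlow.sum_out_mul {w : P → P → ℚ} (h : IsLogConcaveFlowPoset P N ρ)
    (hw : IsNormalizedFlow N ρ w) {x : P} (hx : ρ x < N) :
    levelCard ρ (ρ x) * ∑ y, w x y = 1 := by
  rw [hw.sum_out x hx]
  exact mul_inv_cancel₀ (h.levelCard_pos _ (by omega) (by omega)).ne'

/-- Pushing the indicator of an antichain down to rank `i` along the flow. -/
theorem IsLogConcaveFlowPoset.exists_weight (h : IsLogConcaveFlowPoset P N ρ) {A : Finset P}
    (hA : IsAntichain (· ≤ ·) (A : Set P)) (m i : ℕ) (hi : i + m = N) :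
    ∃ g : P → ℚ, (∀ x, ρ x = i → g x ≤ 1) ∧ (∀ x a, a ∈ A → a < x → g x = 0) ∧
      ∑ x with ρ x = i, g x * (levelCard ρ i)⁻¹ =
        ∑ x ∈ A with i ≤ ρ x, (levelCard ρ (ρ x))⁻¹ := by
  classical
  induction m generalizing i with
  | zero =>
    refine ⟨fun x => if x ∈ A then 1 else 0, fun x _ => by dsimp only; split_ifs <;> norm_num,
      fun x a ha hax => if_neg fun hx => (hA ha hx hax.ne) hax.le, ?_⟩
    have e : A.filter (fun x => i ≤ ρ x) = (Finset.univ.filter fun x => ρ x = i ∧ x ∈ A) := by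
      ext x
      have := h.rank_le x
      simp only [Finset.mem_filter, Finset.mem_univ, true_and]
      constructor
      · rintro ⟨h1, h2⟩; exact ⟨by omega, h1⟩
      · rintro ⟨h1, h2⟩; exact ⟨h2, by omega⟩
    rw [e, ← Finset.filter_filter, Finset.sum_filter (s := Finset.univ.filter _)]
    refine Finset.sum_congr rfl fun x hx => ?_
    rw [(Finset.mem_filter.1 hx).2]
    split_ifs with hxA <;> simp [hxA]
  | succ m ih =>
    obtain ⟨g, hg1, hg0, hg⟩ := ih (i + 1) (by omega)
    obtain ⟨w, hw⟩ := h.exists_flow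
    -- As `g` vanishes above `A`, the weight flowing down into a member of `A` is zero, so replacing
    -- it by 1 loses nothing and keeps the bound 1.
    have hvan : ∀ x a, a ∈ A → a ≤ x → ∀ y, w x y * g y = 0 := fun x a ha hax y => by
      by_cases hxy : w x y = 0
      · rw [hxy, zero_mul]
      · rw [hg0 y a ha (hax.trans_lt (hw.lt _ _ hxy)), mul_zero]
    have hp : 0 < levelCard ρ i := h.levelCard_pos i (by omega) (by omega)
    refine ⟨fun x => if x ∈ A then 1 else levelCard ρ i * ∑ y, w x y * g y,
      fun x hx => ?_, fun x a ha hax => ?_, ?_⟩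
    · dsimp only
      split_ifs
      · exact le_rfl
      -- The new weight is an average of the old ones: the outgoing flow times the level size is a
      -- probability distribution.
      · rw [← hw.sum_out_mul h (x := x) (by omega), hx]
        refine mul_le_mul_of_nonneg_left (Finset.sum_le_sum fun y _ => ?_) hp.le
        by_cases hxy : w x y = 0
        · simp [hxy]
        · exact mul_le_of_le_one_right (hw.nonneg _ _) (hg1 y (by rw [hw.rank _ _ hxy, hx]))
    · dsimp only
      rw [if_neg fun hx : x ∈ A => (hA ha hx hax.ne) hax.le,
        Finset.sum_eq_zero fun y _ => hvan x a ha hax.le y, mul_zero]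
    · have e1 : ∀ x ∈ Finset.univ.filter (fun x => ρ x = i),
          (if x ∈ A then 1 else levelCard ρ i * ∑ y, w x y * g y) * (levelCard ρ i)⁻¹ =
          (if x ∈ A then (levelCard ρ (ρ x))⁻¹ else 0) + ∑ y, w x y * g y := by
        intro x hx
        rw [(Finset.mem_filter.1 hx).2]
        split_ifs with hxA
        · rw [Finset.sum_eq_zero fun y _ => hvan x x hxA le_rfl y]; simp
        · field_simp; simp
      rw [Finset.sum_congr rfl e1, Finset.sum_add_distrib, Finset.sum_comm]
      have e2 : ∑ y, ∑ x with ρ x = i, w x y * g y =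
          ∑ y with ρ y = i + 1, g y * (levelCard ρ (i + 1 : ℕ))⁻¹ := by
        rw [Finset.sum_filter]
        refine Finset.sum_congr rfl fun y _ => ?_
        rw [← Finset.sum_mul]
        split_ifs with hy
        · rw [mul_comm, ← hy, ← hw.sum_in y (by omega), Finset.sum_filter]
          congr 1
          refine Finset.sum_congr rfl fun x _ => ?_
          split_ifs with hx
          · rfl
          · by_contra hxy
            have := hw.rank x y (Ne.symm hxy)
            omega
        · rw [Finset.sum_eq_zero, zero_mul]
          intro x hx
          by_contra hxy
          have := hw.rank x y hxy
          have := (Finset.mem_filter.1 hx).2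
          omega
      rw [e2, hg, ← Finset.sum_filter, Finset.filter_filter]
      have e3 : A.filter (fun x => i ≤ ρ x) =
          (Finset.univ.filter fun x => ρ x = i ∧ x ∈ A) ∪ A.filter (fun x => i + 1 ≤ ρ x) := by
        ext x
        simp only [Finset.mem_filter, Finset.mem_univ, true_and, Finset.mem_union]
        by_cases hx : x ∈ A <;> simp [hx]; omega
      rw [e3, Finset.sum_union]
      rw [Finset.disjoint_left]
      intro x hx hx'
      simp only [Finset.mem_filter, Finset.mem_univ, true_and] at hx hx'
      omega

/-- The LYM inequality. -/
theorem IsLogConcaveFlowPoset.sum_inv_levelCard_le_one (h : IsLogConcaveFlowPoset P N ρ)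
    {A : Finset P} (hA : IsAntichain (· ≤ ·) (A : Set P)) :
    ∑ x ∈ A, (levelCard ρ (ρ x))⁻¹ ≤ 1 := by
  obtain ⟨g, hg1, -, hg⟩ := h.exists_weight hA N 0 (zero_add N)
  have hp : 0 < levelCard ρ (0 : ℕ) := h.levelCard_pos _ (by omega) (by omega)
  simp only [Nat.zero_le, Finset.filter_true] at hg
  rw [← hg, ← Finset.sum_mul, mul_inv_le_iff₀ hp, one_mul]
  calc _ ≤ ∑ x with ρ x = 0, (1 : ℚ) :=
        Finset.sum_le_sum fun x hx => hg1 x (Finset.mem_filter.1 hx).2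
    _ = _ := by simp [levelCard]

/-- A fractional selection of total weight at most `m` cannot beat the `m` largest values. -/
theorem sum_mul_le_sum_of_largest {T S : Finset ℕ} (hST : S ⊆ T) {a f : ℕ → ℚ}
    (ha : ∀ i ∈ T, 0 ≤ a i) (hf0 : ∀ i ∈ T, 0 ≤ f i) (hf1 : ∀ i ∈ T, f i ≤ 1)
    (hf : ∑ i ∈ T, f i ≤ S.card ∨ S = T)
    (hS : ∀ i ∈ S, ∀ j ∈ T, j ∉ S → a j ≤ a i) : ∑ i ∈ T, f i * a i ≤ ∑ i ∈ S, a i := by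
  rcases hf with hf | rfl
  swap
  · exact Finset.sum_le_sum fun i hi => mul_le_of_le_one_left (ha i hi) (hf1 i hi)
  -- A threshold `c` separates the values on `S` from the rest; weight moved from outside `S` into
  -- `S` passes through it without loss.
  obtain ⟨c, hc0, hcS, hcT⟩ : ∃ c, 0 ≤ c ∧ (∀ i ∈ S, c ≤ a i) ∧ ∀ j ∈ T, j ∉ S → a j ≤ c := by
    rcases S.eq_empty_or_nonempty with rfl | hne
    · refine ⟨∑ j ∈ T, a j, Finset.sum_nonneg ha, by simp, fun j hj _ =>
        Finset.single_le_sum ha hj⟩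
    · obtain ⟨i, hi, hmin⟩ := S.exists_min_image a hne
      exact ⟨a i, ha i (hST hi), hmin, fun j hj hjS => hS i hi j hj hjS⟩
  rw [← Finset.sum_sdiff hST] at hf ⊢
  have h1 : ∑ i ∈ T \ S, f i * a i ≤ (∑ i ∈ T \ S, f i) * c := by
    rw [Finset.sum_mul]
    refine Finset.sum_le_sum fun i hi => ?_
    rw [Finset.mem_sdiff] at hi
    exact mul_le_mul_of_nonneg_left (hcT i hi.1 hi.2) (hf0 i hi.1)
  have h2 : (∑ i ∈ S, (1 - f i)) * c ≤ ∑ i ∈ S, (1 - f i) * a i := by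
    rw [Finset.sum_mul]
    exact Finset.sum_le_sum fun i hi =>
      mul_le_mul_of_nonneg_left (hcS i hi) (sub_nonneg.2 (hf1 i (hST hi)))
  simp only [Finset.sum_sub_distrib, sub_mul, one_mul, Finset.sum_const, nsmul_eq_mul,
    mul_one] at h2
  nlinarith [mul_le_mul_of_nonneg_right hf hc0]

theorem IsLogConcaveFlowPoset.hasSpernerProperty (h : IsLogConcaveFlowPoset P N ρ) (m : ℕ) :
    HasSpernerProperty N ρ m := by
  classical
  intro A hA S hS
  obtain ⟨hST, hcard, hlarge⟩ := hS
  have hpos : ∀ x, 0 < levelCard ρ (ρ x) := fun x =>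
    h.levelCard_pos _ (by omega) (by have := h.rank_le x; omega)
  set U : Finset P := Finset.univ.filter fun x => ∃ j, x ∈ A j with hU
  have hUA : (⋃ j, A j) = (U : Set P) := by ext x; simp [hU]
  have hSl : (⋃ i ∈ S, rankLevel ρ i) =
      ((Finset.univ.filter fun x => ρ x ∈ S : Finset P) : Set P) := by
    ext x; simp [rankLevel]
  rw [hUA, hSl, Set.ncard_coe_finset, Set.ncard_coe_finset]
  have hmaps : ∀ V : Finset P, ∀ x ∈ V, ρ x ∈ Finset.range (N + 1) := fun V x _ =>
    Finset.mem_range.2 (Nat.lt_succ_of_le (h.rank_le x))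
  have hLYM : ∑ x ∈ U, (levelCard ρ (ρ x))⁻¹ ≤ m := by
    calc _ ≤ ∑ j : Fin m, ∑ x ∈ Finset.univ.filter (fun x => x ∈ A j), (levelCard ρ (ρ x))⁻¹ := by
          simp only [hU, Finset.sum_filter]
          rw [Finset.sum_comm]
          refine Finset.sum_le_sum fun x _ => ?_
          have hnn : ∀ j ∈ Finset.univ, 0 ≤ if x ∈ A j then (levelCard ρ (ρ x))⁻¹ else 0 :=
            fun j _ => by split_ifs <;> simp [(hpos x).le]
          split_ifs with hx
          · obtain ⟨j, hj⟩ := hx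
            simpa [hj] using Finset.single_le_sum hnn (Finset.mem_univ j)
          · exact Finset.sum_nonneg hnn
      _ ≤ ∑ j : Fin m, (1 : ℚ) := Finset.sum_le_sum fun j _ =>
          h.sum_inv_levelCard_le_one (by simpa using hA j)
      _ = m := by simp
  have hlev : ∀ i ∈ Finset.range (N + 1), 0 < levelCard ρ i := fun i hi =>
    h.levelCard_pos _ (by omega) (by have := Finset.mem_range.1 hi; omega)
  -- Here `f i` is the fraction of level `i` covered by the antichains; by LYM these fractions add
  -- up to at most `m`.
  have key := sum_mul_le_sum_of_largest hST (a := fun i => levelCard ρ i)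
    (f := fun i => ((U.filter fun x => ρ x = i).card : ℚ) * (levelCard ρ i)⁻¹)
    (fun i hi => (hlev i hi).le)
    (fun i hi => mul_nonneg (Nat.cast_nonneg _) (inv_pos.2 (hlev i hi)).le)
    (fun i hi => by
      rw [mul_inv_le_iff₀ (hlev i hi), one_mul, levelCard]
      refine Nat.cast_le.2 (Finset.card_le_card fun x hx => ?_)
      simp only [Finset.mem_filter] at hx
      simp [hx.2])
    (by
      rcases le_total m (N + 1) with hm | hm
      · left
        rw [hcard, min_eq_left hm]
        refine le_trans (le_of_eq ?_) hLYM
        rw [← Finset.sum_fiberwise_of_maps_to (hmaps U)]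
        refine Finset.sum_congr rfl fun i _ => ?_
        rw [Finset.sum_congr rfl fun x hx => by rw [(Finset.mem_filter.1 hx).2]]
        simp
      · right
        refine Finset.eq_of_subset_of_card_le hST ?_
        rw [hcard, min_eq_right hm, Finset.card_range])
    (fun i hi j hj hjS => by
      have := hlarge i hi j hj hjS
      rw [← ncard_rankLevel, ← ncard_rankLevel]
      exact_mod_cast this)
  have e1 : ∑ i ∈ Finset.range (N + 1),
      ((U.filter fun x => ρ x = i).card : ℚ) * (levelCard ρ i)⁻¹ * levelCard ρ i = U.card := by
    rw [Finset.card_eq_sum_card_fiberwise (hmaps U), Nat.cast_sum]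
    exact Finset.sum_congr rfl fun i hi => inv_mul_cancel_right₀ (hlev i hi).ne' _
  have e2 : ∑ i ∈ S, levelCard ρ i = (Finset.univ.filter fun x => ρ x ∈ S : Finset P).card := by
    rw [Finset.card_eq_sum_card_fiberwise (f := ρ) (t := S) (by intro x hx; simpa using hx),
      Nat.cast_sum]
    refine Finset.sum_congr rfl fun i hi => ?_
    rw [levelCard, Finset.filter_filter]
    congr 2
    ext x
    simp only [Finset.mem_filter, Finset.mem_univ, true_and, Nat.cast_inj]
    exact ⟨fun hx => ⟨hx ▸ hi, hx⟩, fun hx => hx.2⟩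
  rw [e1, e2] at key
  exact_mod_cast key

theorem strictMono_of_rank_of_covBy (hρ : ∀ x y : P, y ⋖ x → ρ x = ρ y + 1) : StrictMono ρ := by
  classical
  have := Fintype.toLocallyFiniteOrder (α := P)
  refine (strictMono_iff_forall_covBy ρ).2 fun a b hab => ?_
  rw [hρ b a hab]
  exact Nat.lt_succ_self _

/-- A maximal chain meets each rank exactly once: the rank is strictly monotone, the least element
of the chain is minimal in `P`, and successive elements of the chain are covers until the rank is
`N`. -/
theorem IsLogConcaveFlowPoset.isGradedBy (h : IsLogConcaveFlowPoset P N ρ) :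
    IsGradedBy P N ρ := by
  classical
  refine ⟨fun C hC => ?_, h.rank_of_isMin, h.rank_of_covBy⟩
  have hmono := strictMono_of_rank_of_covBy h.rank_of_covBy
  have hinj : Set.InjOn ρ C := fun x hx y hy hxy => by
    rcases hC.1.total hx hy with hle | hle
    · exact hle.eq_of_not_lt fun hlt => (hmono hlt).ne hxy
    · exact (hle.eq_of_not_lt fun hlt => (hmono hlt).ne' hxy).symm
  have hne : C.Nonempty := by
    -- Level 0 is nonempty, which rules out the empty maximal chain.
    have hp := h.levelCard_pos 0 le_rfl (by omega)
    rw [levelCard, Nat.cast_pos, Finset.card_pos] at hp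
    have : Nonempty P := ⟨hp.choose⟩
    exact hC.nonempty_iff.1 inferInstance
  have himg : ρ '' C = Set.Iio (N + 1) := by
    refine Set.Subset.antisymm (Set.image_subset_iff.2 fun x _ =>
      Nat.lt_succ_of_le (h.rank_le x)) fun i hi => ?_
    have hi : i < N + 1 := hi
    induction i with
    | zero =>
      obtain ⟨x, hx⟩ := (Set.toFinite C).exists_minimal hne
      refine ⟨x, hx.1, h.rank_of_isMin x fun y hyx => ?_⟩
      have hyC : y ∈ C := hC.mem_of_forall_comparable fun z hz => Or.inl <| hyx.trans <|
        (hC.1.total hx.1 hz).elim id fun hzx => hx.2 hz hzx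
      exact hx.2 hyC hyx
    | succ i ih =>
      obtain ⟨x, hxC, hx⟩ := ih (Set.mem_Iio.2 (by omega)) (by omega)
      obtain ⟨y, hxy⟩ : ∃ y, x < y := by
        by_contra hno
        push Not at hno
        have := h.rank_of_isMax x fun y hxy => (hxy.eq_of_not_lt (hno y)).ge
        omega
      have hne' : {z ∈ C | x < z}.Nonempty := by
        by_contra hno
        have hmax : ∀ t ∈ C, t ≤ x := fun t ht => (hC.1.total ht hxC).elim id fun hxt =>
          (hxt.eq_of_not_lt fun hlt => hno ⟨t, ht, hlt⟩).ge
        exact hno ⟨y, hC.mem_of_forall_comparable fun t ht =>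
          Or.inr ((hmax t ht).trans hxy.le), hxy⟩
      obtain ⟨z, hz⟩ := (Set.toFinite {z ∈ C | x < z}).exists_minimal hne'
      refine ⟨z, hz.1.1, ?_⟩
      rw [h.rank_of_covBy z x ⟨hz.1.2, fun c hxc hcz => ?_⟩, hx]
      have hcC : c ∈ C := hC.mem_of_forall_comparable fun t ht => by
        by_cases hxt : x < t
        · rcases hC.1.total hz.1.1 ht with hzt | htz
          · exact Or.inl (hcz.le.trans hzt)
          · exact Or.inl (hcz.le.trans (hz.2 ⟨ht, hxt⟩ htz))
        · rcases hC.1.total hxC ht with hxt' | htx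
          · exact Or.inr ((hxt'.eq_of_not_lt hxt).ge.trans hxc.le)
          · exact Or.inr (htx.trans hxc.le)
      exact (hz.2 ⟨hcC, hxc⟩ hcz.le).not_gt hcz
  rw [← hinj.encard_image, himg, Set.encard_eq_coe_toFinset_card]
  simp

theorem IsLogConcaveFlowPoset.levelCard_mul_le (h : IsLogConcaveFlowPoset P N ρ) (i : ℕ) :
    (rankLevel ρ i).ncard * (rankLevel ρ (i + 2)).ncard ≤ (rankLevel ρ (i + 1)).ncard ^ 2 := by
  have := h.logConcave i (i + 1) 1 (by omega) zero_le_one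
  have hq : ((rankLevel ρ i).ncard * (rankLevel ρ (i + 2)).ncard : ℚ) ≤
      (rankLevel ρ (i + 1)).ncard ^ 2 := by
    rw [ncard_rankLevel, ncard_rankLevel, ncard_rankLevel, sq]
    push_cast
    rwa [add_assoc, one_add_one_eq_two] at this
  exact_mod_cast hq

end sperner

/-! ### The spider and its powers -/

/-- The spider with two legs of length `k`: pairs of numbers up to `k`, one of which vanishes. -/
abbrev Spider (k : ℕ) : Type :=
  {z : Fin (k + 1) × Fin (k + 1) // z.1 = 0 ∨ z.2 = 0}

namespace Spider

variable {k : ℕ}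

/-- The rank function of the spider. -/
def rank (z : Spider k) : ℕ := z.1.1 + z.1.2

/-- The point at distance `a` on the first leg. -/
def left (a : Fin (k + 1)) : Spider k := ⟨(a, 0), Or.inr rfl⟩

/-- The point at distance `a` on the second leg. -/
def right (a : Fin (k + 1)) : Spider k := ⟨(0, a), Or.inl rfl⟩

@[simp] theorem rank_left (a : Fin (k + 1)) : rank (left a) = a := by simp [rank, left]

@[simp] theorem rank_right (a : Fin (k + 1)) : rank (right a) = a := by simp [rank, right]

theorem eq_left_or_right (z : Spider k) : (∃ a, z = left a) ∨ ∃ a, z = right a := by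
  obtain ⟨⟨a, b⟩, h⟩ := z
  rcases h with h | h <;> dsimp only at h <;> subst h
  · exact Or.inr ⟨b, rfl⟩
  · exact Or.inl ⟨a, rfl⟩

theorem left_le_left {a b : Fin (k + 1)} : left a ≤ left b ↔ a ≤ b := by
  simp [left, Subtype.mk_le_mk, Prod.mk_le_mk]

theorem right_le_right {a b : Fin (k + 1)} : right a ≤ right b ↔ a ≤ b := by
  simp [right, Subtype.mk_le_mk, Prod.mk_le_mk]

theorem left_le_right {a b : Fin (k + 1)} : left a ≤ right b ↔ a = 0 := by
  simp [left, right, Subtype.mk_le_mk, Prod.mk_le_mk]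

theorem right_le_left {a b : Fin (k + 1)} : right a ≤ left b ↔ a = 0 := by
  simp [left, right, Subtype.mk_le_mk, Prod.mk_le_mk]

theorem left_eq_right {a b : Fin (k + 1)} : left a = right b ↔ a = 0 ∧ b = 0 := by
  simp [left, right, eq_comm]

theorem rank_le (z : Spider k) : rank z ≤ k := by
  rcases eq_left_or_right z with ⟨a, rfl⟩ | ⟨a, rfl⟩ <;> simp <;> omega

theorem filter_rank {i : ℕ} (hi : i < k + 1) :
    (Finset.univ.filter fun z : Spider k => rank z = i) = {left ⟨i, hi⟩, right ⟨i, hi⟩} := by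
  ext z
  simp only [Finset.mem_filter, Finset.mem_univ, true_and, Finset.mem_insert,
    Finset.mem_singleton]
  constructor
  · rintro rfl
    rcases eq_left_or_right z with ⟨a, rfl⟩ | ⟨a, rfl⟩ <;> simp
  · rintro (rfl | rfl) <;> simp

theorem levelCard_rank (i : ℤ) :
    levelCard (rank (k := k)) i = if i = 0 then 1 else if 0 < i ∧ i ≤ k then 2 else 0 := by
  by_cases h : 0 ≤ i ∧ i ≤ k
  · obtain ⟨j, rfl⟩ := Int.eq_ofNat_of_zero_le h.1
    have hj : j < k + 1 := by omega
    simp only [levelCard, Nat.cast_inj]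
    rw [filter_rank hj]
    by_cases h0 : j = 0
    · subst h0
      have e : left ⟨0, hj⟩ = right ⟨0, hj⟩ := left_eq_right.2 ⟨rfl, rfl⟩
      rw [e]; simp
    · rw [Finset.card_pair (fun e => h0 (by simpa using (left_eq_right.1 e).1)),
        if_neg (by omega), if_pos (by omega)]
      rfl
  · rw [levelCard_eq_zero fun z hz => h ?_, if_neg (by omega), if_neg (by omega)]
    have := rank_le z
    omega

theorem logConcave_levelCard : IsLogConcaveSeq (levelCard (rank (k := k))) := by
  intro i j m hij hm
  simp only [levelCard_rank]
  split_ifs <;> first | omega | norm_num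

theorem rank_strictMono : StrictMono (rank (k := k)) := fun x y h => by
  obtain ⟨h1, h2⟩ := Prod.mk_le_mk.1 h.le
  have h1' : (x.1.1 : ℕ) ≤ y.1.1 := h1
  have h2' : (x.1.2 : ℕ) ≤ y.1.2 := h2
  unfold rank
  by_contra hlt
  exact h.not_ge ⟨Fin.le_def.2 (by omega), Fin.le_def.2 (by omega)⟩

theorem exists_lt_rank_eq_succ {x : Spider k} (hx : rank x < k) :
    ∃ y, x < y ∧ rank y = rank x + 1 := by
  rcases eq_left_or_right x with ⟨a, rfl⟩ | ⟨a, rfl⟩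
  · rw [rank_left] at hx ⊢
    refine ⟨left ⟨a + 1, by omega⟩, lt_iff_le_and_ne.2 ⟨left_le_left.2 ?_, fun e => ?_⟩, by simp⟩
    · exact Fin.le_def.2 (Nat.le_succ _)
    · have := congrArg rank e; simp at this
  · rw [rank_right] at hx ⊢
    refine ⟨right ⟨a + 1, by omega⟩, lt_iff_le_and_ne.2 ⟨right_le_right.2 ?_, fun e => ?_⟩,
      by simp⟩
    · exact Fin.le_def.2 (Nat.le_succ _)
    · have := congrArg rank e; simp at this

theorem exists_rank_eq_succ_le {x y : Spider k} (h : x < y) :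
    ∃ z, x < z ∧ z ≤ y ∧ rank z = rank x + 1 := by
  have hr := rank_strictMono h
  rcases eq_left_or_right y with ⟨b, rfl⟩ | ⟨b, rfl⟩
  · rw [rank_left] at hr
    refine ⟨left ⟨rank x + 1, by omega⟩, lt_of_le_of_ne ?_ fun e => ?_,
      left_le_left.2 (Fin.le_def.2 hr), by simp⟩
    · rcases eq_left_or_right x with ⟨a, rfl⟩ | ⟨a, rfl⟩
      · exact left_le_left.2 (Fin.le_def.2 (by simp))
      · exact right_le_left.2 (right_le_left.1 h.le)
    · have := congrArg rank e; simp at this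
  · rw [rank_right] at hr
    refine ⟨right ⟨rank x + 1, by omega⟩, lt_of_le_of_ne ?_ fun e => ?_,
      right_le_right.2 (Fin.le_def.2 hr), by simp⟩
    · rcases eq_left_or_right x with ⟨a, rfl⟩ | ⟨a, rfl⟩
      · exact left_le_right.2 (left_le_right.1 h.le)
      · exact right_le_right.2 (Fin.le_def.2 (by simp))
    · have := congrArg rank e; simp at this

/-- Every point except the foot has one lower neighbour. Below the top rank it has one upper
neighbour, while the foot has two if `0 < k`. Levels above the foot have two points, so weight 1/2
per cover fits. -/
theorem isNormalizedFlow (k : ℕ) : IsNormalizedFlow k (rank (k := k))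
    fun x y => if x ≤ y ∧ rank y = rank x + 1 then 1 / 2 else 0 := by
  constructor
  · intro x y; split_ifs <;> norm_num
  · intro x y h
    obtain ⟨h1, h2⟩ := (ite_ne_right_iff.1 h).1
    exact lt_of_le_of_ne h1 fun e => by rw [e] at h2; omega
  · intro x y h
    exact (ite_ne_right_iff.1 h).1.2
  · intro x hx
    have e : ∀ y : Spider k, (if x ≤ y ∧ rank y = rank x + 1 then (1 / 2 : ℚ) else 0) =
        if rank y = rank x + 1 then (if x ≤ y then 1 / 2 else 0) else 0 := fun y => by
      rw [← ite_and]; exact if_congr and_comm rfl rfl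
    simp only [e]
    rw [← Finset.sum_filter, filter_rank (by omega), Finset.sum_pair, levelCard_rank]
    · rcases eq_left_or_right x with ⟨a, rfl⟩ | ⟨a, rfl⟩
      · rw [if_pos (left_le_left.2 (Fin.le_def.2 (by simp)))]
        simp only [left_le_right, rank_left] at hx ⊢
        by_cases ha : a = 0
        · subst ha; norm_num
        · have : (0 : ℕ) < a := Nat.pos_of_ne_zero fun e => ha (Fin.ext e)
          rw [if_neg ha, if_neg (by omega), if_pos (by omega)]; norm_num
      · rw [if_pos (right_le_right.2 (Fin.le_def.2 (by simp)) : right a ≤ right _)]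
        simp only [right_le_left, rank_right] at hx ⊢
        by_cases ha : a = 0
        · subst ha; norm_num
        · have : (0 : ℕ) < a := Nat.pos_of_ne_zero fun e => ha (Fin.ext e)
          rw [if_neg ha, if_neg (by omega), if_pos (by omega)]; norm_num
    · intro e
      have := (left_eq_right.1 e).1
      simp [Fin.ext_iff] at this
  · intro y hy
    obtain ⟨i, hi⟩ : ∃ i, rank y = i + 1 := ⟨rank y - 1, by omega⟩
    have hyk := rank_le y
    have e : ∀ x : Spider k, (if x ≤ y ∧ rank y = rank x + 1 then (1 / 2 : ℚ) else 0) =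
        if rank x = i then (if x ≤ y then 1 / 2 else 0) else 0 := fun x => by
      rw [← ite_and]
      exact if_congr (by rw [and_comm, hi]; exact and_congr (by omega) Iff.rfl) rfl rfl
    simp only [e]
    rw [← Finset.sum_filter, filter_rank (by omega), levelCard_rank, if_neg (by omega),
      if_pos (by omega)]
    -- On level 0 the two legs share the foot, so the sum has a single term.
    by_cases h0 : i = 0
    · subst h0
      have e : left ⟨0, k.succ_pos⟩ = right ⟨0, k.succ_pos⟩ := left_eq_right.2 ⟨rfl, rfl⟩
      rw [e, Finset.pair_eq_singleton, Finset.sum_singleton, if_pos]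
      · norm_num
      · exact ⟨Fin.zero_le _, Fin.zero_le _⟩
    have hne : ∀ h : i < k + 1, (⟨i, h⟩ : Fin (k + 1)) ≠ 0 := fun h e =>
      h0 (by simpa [Fin.ext_iff] using e)
    rw [Finset.sum_pair fun e => hne _ (left_eq_right.1 e).1]
    rcases eq_left_or_right y with ⟨b, rfl⟩ | ⟨b, rfl⟩
    · rw [rank_left] at hi
      rw [if_pos (left_le_left.2 (Fin.le_def.2 (by simp [hi]))),
        if_neg fun h => hne _ (right_le_left.1 h)]
      norm_num
    · rw [rank_right] at hi
      rw [if_neg fun h => hne _ (left_le_right.1 h),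
        if_pos (right_le_right.2 (Fin.le_def.2 (by simp [hi])))]
      norm_num

theorem isLogConcaveFlowPoset (k : ℕ) : IsLogConcaveFlowPoset (Spider k) k rank where
  rank_of_isMin x hx := by
    have : x ≤ left 0 := hx (show left 0 ≤ x from ⟨Fin.zero_le _, Fin.zero_le _⟩)
    have := rank_strictMono.monotone this
    simpa using this
  rank_of_isMax x hx := by
    by_contra h
    obtain ⟨y, hxy, -⟩ := exists_lt_rank_eq_succ (lt_of_le_of_ne (rank_le x) h)
    exact hx.not_lt hxy
  rank_of_covBy x y h := by
    obtain ⟨z, hyz, hzx, hz⟩ := exists_rank_eq_succ_le h.lt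
    rw [← hz, hzx.eq_of_not_lt fun hlt => h.2 hyz hlt]
  rank_le := rank_le
  levelCard_pos i h0 hi := by
    rw [levelCard_rank]
    split_ifs <;> first | omega | norm_num
  logConcave := logConcave_levelCard
  exists_flow := ⟨_, isNormalizedFlow k⟩

theorem exists_isLogConcaveFlowPoset_pi (k n : ℕ) :
    ∃ N ρ, IsLogConcaveFlowPoset (Fin n → Spider k) N ρ := by
  induction n with
  | zero =>
    -- The empty power is a single point, for which `Spider 0` serves as a model.
    have : Unique (Spider 0) := ⟨⟨left 0⟩, fun z =>
      Subtype.ext (Prod.ext (Fin.subsingleton_one.elim _ _) (Fin.subsingleton_one.elim _ _))⟩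
    exact ⟨_, _, (isLogConcaveFlowPoset 0).comp_orderIso (OrderIso.ofUnique _ _)⟩
  | succ n ih =>
    obtain ⟨N, ρ, h⟩ := ih
    exact ⟨_, _, ((isLogConcaveFlowPoset k).prod h).comp_orderIso
      (Fin.consOrderIso fun _ : Fin (n + 1) => Spider k).symm⟩

end Spider

/-! ### Chains of flags as points of a power of the spider -/

/-- A monotone predicate on `Fin k` holds exactly for the last `a` elements, for some `a`. -/
theorem exists_forall_iff_le_add {k : ℕ} {p : Fin k → Prop} (hp : Monotone p) :
    ∃ a : Fin (k + 1), ∀ t, p t ↔ k ≤ t + a := by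
  classical
  by_cases h : ∃ t, p t
  · obtain ⟨t, ht, hmin⟩ := (Set.toFinite {t | p t}).exists_minimal h
    refine ⟨⟨k - t, by omega⟩, fun s => ⟨fun hs => ?_, fun hs => ?_⟩⟩
    · rcases le_total s t with hst | hst
      · have := Fin.le_def.1 (hmin hs hst)
        simp only; omega
      · have := Fin.le_def.1 hst
        simp only; omega
    · exact hp (Fin.le_def.2 (by simp only at hs; omega)) ht
  · push Not at h
    exact ⟨0, fun t => ⟨fun ht => (h t ht).elim, fun ht => by simp at ht; omega⟩⟩

/-- The chain of isotropic flags in which `i` belongs to the last `(x i).1.1` flags and `i'` to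
the last `(x i).1.2` flags. -/
def flagChain {n k : ℕ} (x : Fin n → Spider k) : ChainPoset (IsotropicFlags n) k where
  toFun t := ⟨(Finset.univ.filter fun i => k ≤ t + (x i).1.1).disjSum
      (Finset.univ.filter fun i => k ≤ t + (x i).1.2), fun i => by
    simp only [Finset.inl_mem_disjSum, Finset.inr_mem_disjSum, Finset.mem_filter, Finset.mem_univ,
      true_and]
    rintro ⟨h1, h2⟩
    rcases (x i).2 with h | h
    · rw [h] at h1; simp at h1; omega
    · rw [h] at h2; simp at h2; omega⟩
  monotone' t u htu := by
    have := Fin.le_def.1 htu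
    refine Finset.disjSum_mono ?_ ?_ <;> intro i <;>
      simp only [Finset.mem_filter, Finset.mem_univ, true_and] <;> omega

theorem inl_mem_flagChain {n k : ℕ} (x : Fin n → Spider k) (t : Fin k) (i : Fin n) :
    Sum.inl i ∈ (flagChain x t).1 ↔ k ≤ t + (x i).1.1 :=
  Finset.inl_mem_disjSum.trans (by simp)

theorem inr_mem_flagChain {n k : ℕ} (x : Fin n → Spider k) (t : Fin k) (i : Fin n) :
    Sum.inr i ∈ (flagChain x t).1 ↔ k ≤ t + (x i).1.2 :=
  Finset.inr_mem_disjSum.trans (by simp)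

theorem forall_le_add_imp_iff {k : ℕ} {a b : Fin (k + 1)} :
    (∀ t : Fin k, k ≤ t + a → k ≤ t + b) ↔ a ≤ b := by
  refine ⟨fun h => ?_, fun h t ht => ht.trans (Nat.add_le_add_left (Fin.le_def.1 h) _)⟩
  by_contra hlt
  have hlt := Fin.lt_def.1 (not_le.1 hlt)
  -- The first index at which the premise holds; it is below `k` since `b < a` forces `0 < a`.
  have := h ⟨k - a, by omega⟩
  simp only at this
  omega

theorem flagChain_le_flagChain {n k : ℕ} {x y : Fin n → Spider k} :
    flagChain x ≤ flagChain y ↔ x ≤ y := by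
  have h1 : flagChain x ≤ flagChain y ↔ ∀ i, (∀ t, Sum.inl i ∈ (flagChain x t).1 →
      Sum.inl i ∈ (flagChain y t).1) ∧ ∀ t, Sum.inr i ∈ (flagChain x t).1 →
      Sum.inr i ∈ (flagChain y t).1 := by
    refine ⟨fun h i => ⟨fun t ht => h t ht, fun t ht => h t ht⟩, fun h t s hs => ?_⟩
    rcases s with i | i
    · exact (h i).1 t hs
    · exact (h i).2 t hs
  rw [h1]
  simp only [inl_mem_flagChain, inr_mem_flagChain, forall_le_add_imp_iff]
  rfl

/-- Along a chain, membership of `i` or of `i'` is a monotone predicate, hence recorded by a length.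
If both lengths were positive, the last flag would contain `i` and `i'`. -/
theorem flagChain_surjective (n k : ℕ) :
    Function.Surjective (flagChain : (Fin n → Spider k) → ChainPoset (IsotropicFlags n) k) := by
  intro f
  choose a ha using fun i => exists_forall_iff_le_add (p := fun t => Sum.inl i ∈ (f t).1)
    fun t u htu h => f.monotone htu h
  choose b hb using fun i => exists_forall_iff_le_add (p := fun t => Sum.inr i ∈ (f t).1)
    fun t u htu h => f.monotone htu h
  refine ⟨fun i => ⟨(a i, b i), ?_⟩, ?_⟩
  · by_contra hab
    push Not at hab
    have h1 : (a i : ℕ) ≠ 0 := fun e => hab.1 (Fin.ext e)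
    have h2 : (b i : ℕ) ≠ 0 := fun e => hab.2 (Fin.ext e)
    have hk : k - 1 < k := by omega
    exact (f ⟨k - 1, hk⟩).2 i ⟨(ha i _).2 (by simp only; omega), (hb i _).2 (by simp only; omega)⟩
  · refine OrderHom.ext _ _ (funext fun t => Subtype.ext (Finset.ext fun s => ?_))
    rcases s with i | i
    · exact (inl_mem_flagChain _ t i).trans (ha i t).symm
    · exact (inr_mem_flagChain _ t i).trans (hb i t).symm

/-- `I_n[k]` is the `n`-th power of the spider. -/
noncomputable def flagChainOrderIso (n k : ℕ) :
    (Fin n → Spider k) ≃o ChainPoset (IsotropicFlags n) k :=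
  RelIso.ofSurjective (OrderEmbedding.ofMapLEIff flagChain fun _ _ => flagChain_le_flagChain)
    (flagChain_surjective n k)

theorem mainTheorem1 (n k : ℕ) :
    StronglySperner (ChainPoset (IsotropicFlags n) k) ∧
      RankLogConcave (ChainPoset (IsotropicFlags n) k) := by
  obtain ⟨N, ρ, h⟩ := Spider.exists_isLogConcaveFlowPoset_pi k n
  have := Fintype.ofFinite (ChainPoset (IsotropicFlags n) k)
  have h' := h.comp_orderIso (flagChainOrderIso n k).symm
  exact ⟨⟨N, _, h'.isGradedBy, h'.hasSpernerProperty⟩,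
    ⟨N, _, h'.isGradedBy, fun i _ => h'.levelCard_mul_le i⟩⟩
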